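/- Let $\mathcal{H}$ be a Hilbert space of finite dimension $d\ge 1$, let $\mathrm{S}(\mathcal{K})$ denote the set of density operators on a finite-dimensional Hilbert space $\mathcal{K}$, and let $\mathcal{M}=\{M_x\}_{x\in\mathcal{X}}$ be a POVM on $\mathcal{H}$ with finite outcome set $\mathcal{X}$. For $0\le r\le n$ and $\sigma\in \mathrm{S}(\mathcal{H})$, a state $\rho\in \mathrm{S}(\mathcal{H}^{\otimes n})$ is called an $\binom{n}{r}$-almost-iid state in $\sigma$ if there exist a finite-dimensional Hilbert space $\mathcal{E}$, a purification $\theta\in\mathcal{H}\otimes\mathcal{E}$ of $\sigma$ (that is, $\mathrm{tr}_{\mathcal{E}}|\theta\rangle\langle\theta|=\sigma$) and a state $R\in \mathrm{S}((\mathcal{H}\otimes\mathcal{E})^{\otimes n})$ with $\mathrm{tr}_{\mathcal{E}^{\otimes n}}[R]=\rho$ such that (i) $\pi R\pi^\dagger=R$ for every permutation $\pi$ of the $n$ factors $\mathcal{H}\otimes\mathcal{E}$, and (ii) the support $(\ker R)^\perp$ of $R$ is contained in the linear span of all vectors $\pi(\theta^{\otimes (n-r)}\otimes\Omega)$, where $\pi$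 is a permutation of the $n$ factors and $\Omega\in(\mathcal{H}\otimes\mathcal{E})^{\otimes r}$. For $\mathbf{x}=(x_1,\dots,x_n)\in\mathcal{X}^n$ let $\lambda_{\mathbf{x}}(y)=\frac1n|\{i: x_i=y\}|$ for $y\in\mathcal{X}$. Let $\log$ be the logarithm to base $2$, let $h(p)=-p\log p-(1-p)\log(1-p)$ be the binary entropy (with $0\log 0=0$), and let $$f(\varepsilon,r,n)=2\sqrt{\frac{\log(1/\varepsilon)}{n}+\frac{|\mathcal{X}|}{n}\log\Big(\frac n2+1\Big)+h\Big(\frac rn\Big)+\frac{2r}{n}\log d}+\frac{2r}{n},$$ where the square root of a negative number (which can occur only for $\varepsilon>1$, if $r\le n$) is read as $0$. Then the following hold. (a) Let $n\ge 1$ and $r\ge 0$ be integers with $r\le n/2$, let $\sigma\in \mathrm{S}(\mathcal{H})$, let $\rho$ be an $\binom{n}{r}$-almost-iid state in $\sigma$, and let $P_X(x)=\mathrm{tr}[M_x\sigma]$ for $x\in\mathcal{X}$. Then for every $\varepsilon>0$, $$\mathbb{P}_{\mathbf{x}}\big[\|\lambda_{\mathbf{x}}-P_X\|_1>f(\varepsilon,r,n)\big]\le\varepsilon,$$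 where $\mathbf{x}$ is the outcome of the product measurement $\mathcal{M}^{\otimes n}$ applied to $\rho$, that is, $\mathbf{x}$ has probability $\mathrm{tr}[(M_{x_1}\otimes\cdots\otimes M_{x_n})\rho]$. (b) For every $\varepsilon>0$ and every sequence of nonnegative integers $r=r(n)$ with $r(n)=o(n)$, we have $\lim_{n\to\infty}f(\varepsilon,r(n),n)=0$. -/

import Mathlib

open Filter Topology Asymptotics
open scoped ComplexOrder

noncomputable section

namespace AlmostIID

/-- A density matrix on the Hilbert space `ℂ^ι`. -/
def IsDensity {ι : Type*} [Fintype ι] (ρ : Matrix ι ι ℂ) : Prop :=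
  ρ.PosSemidef ∧ ρ.trace = 1

/-- A POVM on `ℂ^ι` with finite outcome set `X`. -/
def IsPOVM {ι X : Type*} [DecidableEq ι] [Fintype X] (M : X → Matrix ι ι ℂ) : Prop :=
  (∀ x, (M x).PosSemidef) ∧ ∑ x, M x = 1

/-- The operator `A 0 ⊗ ⋯ ⊗ A (n-1)` on `(ℂ^ι)^{⊗ n} = ℂ^(ι^n)`. -/
def tensorOp {ι : Type*} {n : ℕ} (A : Fin n → Matrix ι ι ℂ) :
    Matrix (Fin n → ι) (Fin n → ι) ℂ :=
  Matrix.of fun a b => ∏ k, A k (a k) (b k)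

/-- The vector `θ ∈ ℂ^ι ⊗ ℂ^κ` is a purification of `σ`, i.e. `tr_κ |θ⟩⟨θ| = σ`. -/
def IsPurification {ι κ : Type*} [Fintype κ] (σ : Matrix ι ι ℂ)
    (θ : EuclideanSpace ℂ (ι × κ)) : Prop :=
  ∀ a b, ∑ e, θ (a, e) * star (θ (b, e)) = σ a b

/-- The partial trace of an operator on `(ℂ^ι ⊗ ℂ^κ)^{⊗ n}` over the `n` factors `ℂ^κ`. -/
def partialTrace {ι κ : Type*} [Fintype κ] {n : ℕ}
    (R : Matrix (Fin n → ι × κ) (Fin n → ι × κ) ℂ) : Matrix (Fin n → ι) (Fin n → ι) ℂ :=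
  Matrix.of fun a b => ∑ e : Fin n → κ, R (fun k => (a k, e k)) (fun k => (b k, e k))

/-- Invariance of an operator on `(ℂ^κ)^{⊗ n}` under all permutations of the factors,
`π R π† = R`. -/
def IsPermInvariant {κ : Type*} {n : ℕ} (R : Matrix (Fin n → κ) (Fin n → κ) ℂ) : Prop :=
  ∀ π : Equiv.Perm (Fin n), ∀ i j : Fin n → κ, R (i ∘ π) (j ∘ π) = R i j

/-- The action of a permutation on `(ℂ^κ)^{⊗ n}` by permuting the factors. -/
def permVec {κ : Type*} {n : ℕ} (π : Equiv.Perm (Fin n))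
    (ψ : EuclideanSpace ℂ (Fin n → κ)) : EuclideanSpace ℂ (Fin n → κ) :=
  WithLp.toLp 2 fun i => ψ (i ∘ π)

/-- The vector `θ^{⊗ m} ⊗ Ω` of `(ℂ^κ)^{⊗ n}`, where `n = m + k` and `Ω ∈ (ℂ^κ)^{⊗ k}`. -/
def powTensor {κ : Type*} {m k n : ℕ} (h : m + k = n) (θ : EuclideanSpace ℂ κ)
    (Ω : EuclideanSpace ℂ (Fin k → κ)) : EuclideanSpace ℂ (Fin n → κ) :=
  WithLp.toLp 2 fun i =>
    (∏ j : Fin m, θ (i (Fin.cast h (Fin.castAdd k j)))) *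
      Ω (fun j : Fin k => i (Fin.cast h (Fin.natAdd m j)))

/-- The set of all vectors `π (θ^{⊗ m} ⊗ Ω)` of `(ℂ^κ)^{⊗ n}`, where `n = m + k`. -/
def defectVectors {κ : Type*} {m k n : ℕ} (h : m + k = n) (θ : EuclideanSpace ℂ κ) :
    Set (EuclideanSpace ℂ (Fin n → κ)) :=
  {ψ | ∃ (π : Equiv.Perm (Fin n)) (Ω : EuclideanSpace ℂ (Fin k → κ)),
    ψ = permVec π (powTensor h θ Ω)}

/-- The support of an operator, the orthogonal complement of its kernel. -/
def opSupport {κ : Type*} [Fintype κ] [DecidableEq κ] (R : Matrix κ κ ℂ) :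
    Submodule ℂ (EuclideanSpace ℂ κ) :=
  (LinearMap.ker (Matrix.toEuclideanLin R))ᗮ

/-- `ρ` is an `(n choose r)`-almost-iid state in `σ`: for some purification `θ` of `σ` there is an
extension `R` of `ρ` to `(ℂ^ι ⊗ ℂ^e)^{⊗ n}` that is permutation invariant and supported on
the span of the vectors that equal `θ` on `n - r` of the factors. -/
def IsAlmostIID {ι : Type*} [Fintype ι] [DecidableEq ι] (n r : ℕ)
    (σ : Matrix ι ι ℂ) (ρ : Matrix (Fin n → ι) (Fin n → ι) ℂ) : Prop :=
  IsDensity σ ∧ IsDensity ρ ∧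
    ∃ (hr : r ≤ n) (e : ℕ) (θ : EuclideanSpace ℂ (ι × Fin e))
      (R : Matrix (Fin n → ι × Fin e) (Fin n → ι × Fin e) ℂ),
      IsPurification σ θ ∧ IsDensity R ∧ partialTrace R = ρ ∧ IsPermInvariant R ∧
        opSupport R ≤ Submodule.span ℂ (defectVectors (Nat.sub_add_cancel hr) θ)

/-- The outcome distribution `x ↦ tr[M_x σ]` of the measurement `M` in the state `σ`. -/
def outcomeProb {ι X : Type*} [Fintype ι] (M : X → Matrix ι ι ℂ) (σ : Matrix ι ι ℂ) (x : X) : ℝ :=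
  (M x * σ).trace.re

/-- The product measurement `M^{⊗ n}`, with outcomes in `X^n`. -/
def productPOVM {ι X : Type*} (M : X → Matrix ι ι ℂ) (n : ℕ) :
    (Fin n → X) → Matrix (Fin n → ι) (Fin n → ι) ℂ :=
  fun x => tensorOp fun k => M (x k)

/-- The probability of the event `W` when the measurement `M` is applied to the state `σ`. -/
def eventProb {ι X : Type*} [Fintype ι] [Fintype X] (M : X → Matrix ι ι ℂ) (σ : Matrix ι ι ℂ)
    (W : Set X) : ℝ :=
  ∑ x, W.indicator (outcomeProb M σ) x

/-- The frequency distribution (type) of a sequence. -/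
def freq {X : Type*} [DecidableEq X] {n : ℕ} (x : Fin n → X) (y : X) : ℝ :=
  ((Finset.univ.filter fun i => x i = y).card : ℝ) / n

/-- The `ℓ¹` distance of two functions on a finite set. -/
def l1Dist {X : Type*} [Fintype X] (P Q : X → ℝ) : ℝ := ∑ y, |P y - Q y|

/-- The binary entropy function, in bits. -/
def binEntropyBits (x : ℝ) : ℝ := -x * Real.logb 2 x - (1 - x) * Real.logb 2 (1 - x)

/-- The deviation bound, for an alphabet of size `c` and a Hilbert space of dimension `d`. -/
def deviation (c d : ℕ) (ε : ℝ) (r n : ℕ) : ℝ :=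
  2 * √(Real.logb 2 (1 / ε) / n + (c : ℝ) / n * Real.logb 2 ((n : ℝ) / 2 + 1)
      + binEntropyBits ((r : ℝ) / n) + 2 * (r : ℝ) / n * Real.logb 2 d)
    + 2 * (r : ℝ) / n

end AlmostIID

end

open AlmostIID

namespace AlmostIID

open Matrix Kronecker

/-! ### Tensor products of operators, positivity, pinching. -/

section TensorOp

variable {κ : Type*} {n : ℕ}

/-! For a set `T` of sites let `P_T` (`defectProj`) be `|θ⟩⟨θ|` outside `T` and `1 - |θ⟩⟨θ|` on `T`.
These Hermitian projections sum to `1`. A vector equal to `θ` on `n - r` sites is killed by `P_T`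
once `|T| > r`, so the sum `Π` of the `P_T` with `|T| ≤ r` satisfies `Π R = R`
(`sum_defectProj_mul_eq`).

Lift the product measurement to operators `L_x` on the extension. Pinching (`re_trace_pinching`)
bounds `tr[L_x R] = tr[Π L_x Π R]` by `N ∑ tr[P_T L_x P_T R]`, with `N` the number of such `T`. In
`P_T L_x P_T` each site outside `T` contributes only the scalar `P_X(x_k)`: up to at most `r` sites
the outcomes are iid.

Those `r` sites move the frequencies by at most `2r/n` in `ℓ¹`. A remaining deviation `δ` makes some
event `A ⊆ X` overrepresented outside `T` (`exists_subset_deviation`). Hoeffding's bound and a union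
over the `2^|X|` events give `N 2^|X| exp(-nδ²/2)`, where `N ≤ 2^(n h(r/n))`. With `δ` twice the
square root in `f`, this is at most `ε` for `ε ≤ 1`; for `ε ≥ 1` the claim is trivial. -/

theorem tensorOp_mul [Fintype κ] (A B : Fin n → Matrix κ κ ℂ) :
    tensorOp A * tensorOp B = tensorOp fun k => A k * B k := by
  classical
  ext a c
  simp only [tensorOp, Matrix.mul_apply, Matrix.of_apply, Finset.prod_univ_sum,
    Fintype.piFinset_univ, Finset.prod_mul_distrib]

theorem tensorOp_one [DecidableEq κ] : tensorOp (fun _ : Fin n => (1 : Matrix κ κ ℂ)) = 1 := by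
  ext a b
  simp only [tensorOp, Matrix.of_apply, Matrix.one_apply, funext_iff]
  rw [Finset.prod_ite_zero]
  simp

theorem tensorOp_conjTranspose (A : Fin n → Matrix κ κ ℂ) :
    (tensorOp A)ᴴ = tensorOp fun k => (A k)ᴴ := by
  ext a b
  simp [tensorOp, Matrix.conjTranspose_apply]

theorem tensorOp_smul (c : Fin n → ℂ) (A : Fin n → Matrix κ κ ℂ) :
    tensorOp (fun k => c k • A k) = (∏ k, c k) • tensorOp A := by
  ext a b
  simp [tensorOp, Finset.prod_mul_distrib]

theorem tensorOp_eq_zero {A : Fin n → Matrix κ κ ℂ} (k : Fin n) (hk : A k = 0) :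
    tensorOp A = 0 := by
  ext a b
  simp only [tensorOp, Matrix.of_apply, Matrix.zero_apply]
  exact Finset.prod_eq_zero (Finset.mem_univ k) (by simp [hk])

theorem sum_tensorOp {X : Type*} [Fintype X] [DecidableEq X] (A : Fin n → X → Matrix κ κ ℂ) :
    ∑ x : Fin n → X, tensorOp (fun k => A k (x k)) = tensorOp fun k => ∑ y, A k y := by
  ext a b
  simp only [tensorOp, Matrix.of_apply, Matrix.sum_apply, Finset.prod_univ_sum,
    Fintype.piFinset_univ]

theorem sum_tensorOp_ite (A B : Matrix κ κ ℂ) :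
    ∑ T : Finset (Fin n), tensorOp (fun k => if k ∈ T then A else B) =
      tensorOp fun _ => A + B := by
  ext a b
  simp only [tensorOp, Matrix.of_apply, Matrix.sum_apply, Matrix.add_apply, Fintype.prod_add]
  refine Finset.sum_congr rfl fun T _ => ?_
  rw [← Finset.prod_mul_prod_compl T]
  congr 1
  · exact Finset.prod_congr rfl fun k hk => by simp [hk]
  · exact Finset.prod_congr rfl fun k hk => by simp [Finset.mem_compl.1 hk]

theorem _root_.Matrix.PosSemidef.exists_eq_conjTranspose_mul_self {m : Type*} [Fintype m]
    [DecidableEq m] {A : Matrix m m ℂ} (hA : A.PosSemidef) : ∃ B : Matrix m m ℂ, A = Bᴴ * B := by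
  open scoped MatrixOrder Matrix.Norms.L2Operator in
  exact CStarAlgebra.nonneg_iff_eq_star_mul_self.mp hA.nonneg

theorem tensorOp_posSemidef [Fintype κ] [DecidableEq κ] {A : Fin n → Matrix κ κ ℂ}
    (hA : ∀ k, (A k).PosSemidef) : (tensorOp A).PosSemidef := by
  choose B hB using fun k => (hA k).exists_eq_conjTranspose_mul_self
  have h : tensorOp A = (tensorOp B)ᴴ * tensorOp B := by
    rw [tensorOp_conjTranspose, tensorOp_mul]
    exact congrArg tensorOp (funext hB)
  rw [h]
  exact Matrix.posSemidef_conjTranspose_mul_self _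

theorem _root_.Matrix.PosSemidef.trace_mul_nonneg {m : Type*} [Fintype m]
    {A B : Matrix m m ℂ} (hA : A.PosSemidef) (hB : B.PosSemidef) : 0 ≤ (A * B).trace := by
  classical
  obtain ⟨C, rfl⟩ := hB.exists_eq_conjTranspose_mul_self
  rw [← Matrix.mul_assoc, Matrix.trace_mul_comm, ← Matrix.mul_assoc]
  exact (hA.mul_mul_conjTranspose_same C).trace_nonneg

theorem _root_.Matrix.PosSemidef.re_trace_mul_nonneg {m : Type*} [Fintype m]
    {A B : Matrix m m ℂ} (hA : A.PosSemidef) (hB : B.PosSemidef) : 0 ≤ (A * B).trace.re :=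
  (Complex.nonneg_iff.1 (hA.trace_mul_nonneg hB)).1

/-- A pinching inequality: `Π A Π ≤ |s| ∑ P_t A P_t`, where `Π = ∑ P_t`, tested against `R ≥ 0`. -/
theorem re_trace_pinching {m τ : Type*} [Fintype m] {A R : Matrix m m ℂ}
    (hA : A.PosSemidef) (hR : R.PosSemidef) (s : Finset τ) (P : τ → Matrix m m ℂ)
    (hP : ∀ t, (P t).IsHermitian) :
    ((∑ t ∈ s, P t) * A * (∑ t ∈ s, P t) * R).trace.re ≤
      s.card * ∑ t ∈ s, (P t * A * P t * R).trace.re := by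
  -- Cauchy–Schwarz in quadratic form: expanding these nonnegative terms gives twice the difference
  -- of the two sides. Orthogonality of the `P t` plays no role.
  have key : 0 ≤ ∑ t ∈ s, ∑ u ∈ s, ((P t - P u) * A * (P t - P u) * R).trace.re := by
    refine Finset.sum_nonneg fun t _ => Finset.sum_nonneg fun u _ => ?_
    have h := hA.conjTranspose_mul_mul_same (P t - P u)
    rw [((hP t).sub (hP u)).eq] at h
    exact h.re_trace_mul_nonneg hR
  have expand : ∀ t u, ((P t - P u) * A * (P t - P u) * R).trace.re =
      (P t * A * P t * R).trace.re - (P t * A * P u * R).trace.re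
        - (P u * A * P t * R).trace.re + (P u * A * P u * R).trace.re := by
    intro t u
    simp only [Matrix.sub_mul, Matrix.mul_sub, Matrix.trace_sub, Complex.sub_re]
    ring
  have cross : ((∑ t ∈ s, P t) * A * (∑ t ∈ s, P t) * R).trace.re =
      ∑ t ∈ s, ∑ u ∈ s, (P t * A * P u * R).trace.re := by
    simp only [Finset.sum_mul, Finset.mul_sum, Matrix.trace_sum, Complex.re_sum]
    exact Finset.sum_comm
  simp only [expand, Finset.sum_add_distrib, Finset.sum_sub_distrib, Finset.sum_const,
    nsmul_eq_mul, ← Finset.mul_sum] at key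
  rw [cross]
  have h2 := Finset.sum_comm (s := s) (t := s) (f := fun t u => (P u * A * P t * R).trace.re)
  linarith

end TensorOp

/-! ### Passing to the purifying extension. -/

section Extension

variable {ι : Type*} [Fintype ι] {e n : ℕ}

theorem trace_tensorOp_mul_partialTrace (A : Fin n → Matrix ι ι ℂ)
    (R : Matrix (Fin n → ι × Fin e) (Fin n → ι × Fin e) ℂ) :
    (tensorOp A * partialTrace R).trace =
      (tensorOp (fun k => A k ⊗ₖ (1 : Matrix (Fin e) (Fin e) ℂ)) * R).trace := by
  classical
  have h1 : ∀ c d : Fin n → Fin e, ∏ k, (1 : Matrix (Fin e) (Fin e) ℂ) (c k) (d k) =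
      if c = d then 1 else 0 := fun c d => by
    have := congrFun (congrFun (tensorOp_one (κ := Fin e) (n := n)) c) d
    simpa [tensorOp, Matrix.one_apply] using this
  let E := Equiv.arrowProdEquivProdArrow (Fin n) (fun _ => ι) (fun _ => Fin e)
  simp only [Matrix.trace, Matrix.diag, Matrix.mul_apply, tensorOp, partialTrace, Matrix.of_apply,
    Matrix.kroneckerMap_apply, Finset.prod_mul_distrib]
  rw [← Equiv.sum_comp E.symm, Fintype.sum_prod_type]
  refine Finset.sum_congr rfl fun a _ => ?_
  simp_rw [← Equiv.sum_comp E.symm (fun j : Fin n → ι × Fin e => _ * R j _),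
    Fintype.sum_prod_type]
  rw [Finset.sum_comm]
  refine Finset.sum_congr rfl fun b _ => ?_
  simp [E, Equiv.arrowProdEquivProdArrow, h1, Finset.mul_sum]

/-- The rank-one operator `|θ⟩⟨θ|`. -/
noncomputable def rankOne {κ : Type*} (θ : EuclideanSpace ℂ κ) : Matrix κ κ ℂ :=
  vecMulVec θ (star (θ : κ → ℂ))

theorem rankOne_apply {κ : Type*} (θ : EuclideanSpace ℂ κ) (a b : κ) :
    rankOne θ a b = θ a * star (θ b) := rfl

theorem rankOne_isHermitian {κ : Type*} (θ : EuclideanSpace ℂ κ) : (rankOne θ).IsHermitian := by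
  ext a b
  simp [rankOne_apply, Matrix.conjTranspose_apply, mul_comm]

theorem rankOne_mul_mul {κ : Type*} [Fintype κ] (θ : EuclideanSpace ℂ κ) (A : Matrix κ κ ℂ) :
    rankOne θ * A * rankOne θ = (∑ a, ∑ b, star (θ a) * A a b * θ b) • rankOne θ := by
  ext i j
  simp only [Matrix.mul_apply, rankOne_apply, Matrix.smul_apply, smul_eq_mul, Finset.sum_mul]
  rw [Finset.sum_comm]
  exact Finset.sum_congr rfl fun a _ => Finset.sum_congr rfl fun b _ => by ring

/-- Identifies the scalar left by compressing a lifted POVM element to `θ` (`rankOne_mul_mul`) as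
its probability in `σ`. -/
theorem IsPurification.sum_kronecker {σ : Matrix ι ι ℂ} {θ : EuclideanSpace ℂ (ι × Fin e)}
    (h : IsPurification σ θ) (A : Matrix ι ι ℂ) :
    ∑ a, ∑ b, star (θ a) * (A ⊗ₖ (1 : Matrix (Fin e) (Fin e) ℂ)) a b * θ b =
      (A * σ).trace := by
  simp only [Matrix.trace, Matrix.diag, Matrix.mul_apply, ← h _ _, Fintype.sum_prod_type,
    Matrix.kroneckerMap_apply, Matrix.one_apply, mul_ite, ite_mul, mul_one, mul_zero, zero_mul,
    Finset.sum_ite_eq, Finset.mem_univ, if_true, Finset.mul_sum]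
  refine Finset.sum_congr rfl fun a _ => ?_
  rw [Finset.sum_comm]
  exact Finset.sum_congr rfl fun b _ => Finset.sum_congr rfl fun c _ => by ring

theorem IsPurification.sum_star_mul {σ : Matrix ι ι ℂ} {θ : EuclideanSpace ℂ (ι × Fin e)}
    (h : IsPurification σ θ) (hσ : σ.trace = 1) : ∑ a, star (θ a) * θ a = 1 := by
  rw [← hσ, Matrix.trace, Fintype.sum_prod_type]
  refine Finset.sum_congr rfl fun a _ => ?_
  rw [Matrix.diag, ← h]
  exact Finset.sum_congr rfl fun c _ => mul_comm _ _

end Extension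

/-! ### Defect projections and the support condition. -/

section Defect

variable {κ : Type*} [DecidableEq κ] {n : ℕ}

theorem rankOne_mul_self [Fintype κ] {θ : EuclideanSpace ℂ κ} (h : ∑ a, star (θ a) * θ a = 1) :
    rankOne θ * rankOne θ = rankOne θ := by
  have h1 := rankOne_mul_mul θ 1
  have h2 : ∑ a, ∑ b, star (θ a) * (1 : Matrix κ κ ℂ) a b * θ b = 1 := by
    simpa [Matrix.one_apply] using h
  rwa [Matrix.mul_one, h2, one_smul] at h1

/-- The projection onto the vectors that are `θ` at the factors outside `T` and orthogonal to `θ`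
at the factors in `T`. -/
noncomputable def defectProj (θ : EuclideanSpace ℂ κ) (T : Finset (Fin n)) :
    Matrix (Fin n → κ) (Fin n → κ) ℂ :=
  tensorOp fun k => if k ∈ T then 1 - rankOne θ else rankOne θ

theorem defectProj_isHermitian (θ : EuclideanSpace ℂ κ) (T : Finset (Fin n)) :
    (defectProj θ T).IsHermitian := by
  rw [Matrix.IsHermitian, defectProj, tensorOp_conjTranspose]
  congr 1
  funext k
  have := (rankOne_isHermitian θ).eq
  split_ifs <;> simp [this]

theorem defectProj_mul_self [Fintype κ] {θ : EuclideanSpace ℂ κ} (h : ∑ a, star (θ a) * θ a = 1)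
    (T : Finset (Fin n)) : defectProj θ T * defectProj θ T = defectProj θ T := by
  rw [defectProj, tensorOp_mul]
  congr 1
  funext k
  have := rankOne_mul_self h
  split_ifs <;> simp [this, Matrix.sub_mul, Matrix.mul_sub]

theorem sum_defectProj (θ : EuclideanSpace ℂ κ) :
    ∑ T : Finset (Fin n), defectProj θ T = 1 := by
  simp only [defectProj, sum_tensorOp_ite, sub_add_cancel, tensorOp_one]

theorem tensorOp_single_mulVec [Fintype κ] (k : Fin n) (A : Matrix κ κ ℂ) (v : (Fin n → κ) → ℂ)
    (a : Fin n → κ) :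
    (tensorOp (fun j => if j = k then A else 1) *ᵥ v) a =
      ∑ c, A (a k) c * v (Function.update a k c) := by
  have h1 : ∀ b, tensorOp (fun j => if j = k then A else 1) a b =
      ∑ c, if b = Function.update a k c then A (a k) c else 0 := by
    intro b
    simp only [tensorOp, Matrix.of_apply]
    rw [← Finset.mul_prod_erase _ _ (Finset.mem_univ k)]
    have h2 : ∏ j ∈ Finset.univ.erase k, (if j = k then A else 1) (a j) (b j) =
        ∏ j ∈ Finset.univ.erase k, if a j = b j then (1 : ℂ) else 0 :=
      Finset.prod_congr rfl fun j hj => by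
        rw [if_neg (Finset.ne_of_mem_erase hj), Matrix.one_apply]
    rw [h2, Finset.prod_ite_zero, Finset.prod_const_one, if_pos rfl]
    have h3 : ∀ c, b = Function.update a k c ↔
        c = b k ∧ ∀ j ∈ Finset.univ.erase k, a j = b j := by
      intro c
      rw [Function.eq_update_iff]
      simp only [Finset.mem_erase, Finset.mem_univ, and_true]
      constructor
      · rintro ⟨h, h'⟩; exact ⟨h.symm, fun j hj => (h' j hj).symm⟩
      · rintro ⟨h, h'⟩; exact ⟨h.symm, fun j hj => (h' j hj).symm⟩
    simp only [h3, ite_and, Finset.sum_ite_eq', Finset.mem_univ, if_true]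
    split_ifs <;> simp
  simp only [Matrix.mulVec, dotProduct, h1, Finset.sum_mul]
  rw [Finset.sum_comm]
  refine Finset.sum_congr rfl fun c _ => ?_
  simp

/-- The hypothesis `hv` is a division-free way to say that `v` has the factor `θ` at site `k`. Then
`|θ⟩⟨θ|` at `k` fixes `v`, while `P_T` carries the complementary projection there. -/
theorem defectProj_mulVec_eq_zero [Fintype κ] {θ : EuclideanSpace ℂ κ} (h : ∑ a, star (θ a) * θ a = 1)
    {T : Finset (Fin n)} {k : Fin n} (hk : k ∈ T) {v : (Fin n → κ) → ℂ}
    (hv : ∀ a c, v (Function.update a k c) * θ (a k) = v a * θ c) :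
    defectProj θ T *ᵥ v = 0 := by
  have hfix : tensorOp (fun j => if j = k then rankOne θ else 1) *ᵥ v = v := by
    funext a
    rw [tensorOp_single_mulVec]
    calc _ = ∑ c, v a * (star (θ c) * θ c) := Finset.sum_congr rfl fun c _ => by
            rw [rankOne_apply]; linear_combination star (θ c) * hv a c
      _ = v a := by rw [← Finset.mul_sum, h, mul_one]
  rw [← hfix, Matrix.mulVec_mulVec, defectProj, tensorOp_mul, tensorOp_eq_zero k,
    Matrix.zero_mulVec]
  simp [hk, Matrix.sub_mul, rankOne_mul_self h]

/-- Pigeonhole: more than `r` sites of `T` must meet the `n - r` sites, enumerated by `g`, that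
carry `θ`. -/
theorem defectProj_mulVec_defectVectors [Fintype κ] {m r : ℕ} (hn : m + r = n) {θ : EuclideanSpace ℂ κ}
    (h : ∑ a, star (θ a) * θ a = 1) {T : Finset (Fin n)} (hT : r < T.card)
    {ψ : EuclideanSpace ℂ (Fin n → κ)} (hψ : ψ ∈ defectVectors hn θ) :
    defectProj θ T *ᵥ (ψ : (Fin n → κ) → ℂ) = 0 := by
  obtain ⟨π, Ω, rfl⟩ := hψ
  let g : Fin m → Fin n := fun j => π (Fin.cast hn (Fin.castAdd r j))
  have hg : Function.Injective g := fun i j hij => by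
    have := congrArg Fin.val (π.injective hij)
    exact Fin.ext (by simpa using this)
  have hex : ∃ j, g j ∈ T := by
    by_contra! hno
    have hdisj : Disjoint T (Finset.univ.image g) := by
      rw [Finset.disjoint_right]
      intro x hx
      obtain ⟨j, -, rfl⟩ := Finset.mem_image.1 hx
      exact hno j
    have := Finset.card_le_univ (T ∪ Finset.univ.image g)
    rw [Finset.card_union_of_disjoint hdisj, Finset.card_image_of_injective _ hg] at this
    simp at this
    omega
  obtain ⟨j₀, hj₀⟩ := hex
  refine defectProj_mulVec_eq_zero h hj₀ fun a c => ?_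
  have hval : ∀ i : Fin n → κ, (permVec π (powTensor hn θ Ω)) i =
      (∏ j, θ (i (g j))) * Ω (fun j => i (π (Fin.cast hn (Fin.natAdd m j)))) := fun i => rfl
  have hΩ : (fun j => Function.update a (g j₀) c (π (Fin.cast hn (Fin.natAdd m j)))) =
      fun j => a (π (Fin.cast hn (Fin.natAdd m j))) := by
    funext j
    refine Function.update_of_ne (fun hc => ?_) _ _
    have := congrArg Fin.val (π.injective hc)
    simp at this
    omega
  rw [hval, hval, hΩ, ← Finset.mul_prod_erase _ _ (Finset.mem_univ j₀),
    ← Finset.mul_prod_erase _ (fun j => θ (a (g j))) (Finset.mem_univ j₀),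
    Function.update_self]
  have hrest : ∏ j ∈ Finset.univ.erase j₀, θ (Function.update a (g j₀) c (g j)) =
      ∏ j ∈ Finset.univ.erase j₀, θ (a (g j)) := Finset.prod_congr rfl fun j hj => by
    rw [Function.update_of_ne (hg.ne (Finset.ne_of_mem_erase hj))]
  rw [hrest]
  ring

theorem mulVec_mem_opSupport {m : Type*} [Fintype m] [DecidableEq m] {R : Matrix m m ℂ}
    (hR : R.IsHermitian) (w : m → ℂ) : WithLp.toLp 2 (R *ᵥ w) ∈ opSupport R := by
  rw [opSupport, Submodule.mem_orthogonal]
  intro u hu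
  have hu0 : R *ᵥ (u : m → ℂ) = 0 := by
    have := congrArg WithLp.ofLp (LinearMap.mem_ker.1 hu)
    simpa using this
  rw [EuclideanSpace.inner_eq_star_dotProduct]
  change (R *ᵥ w) ⬝ᵥ star (u : m → ℂ) = 0
  have : star (u : m → ℂ) ᵥ* R = 0 := by
    rw [← hR.eq, ← Matrix.star_mulVec, hu0, star_zero]
  rw [dotProduct_comm, Matrix.dotProduct_mulVec, this, zero_dotProduct]

theorem sum_defectProj_mul_eq [Fintype κ] {m r : ℕ} (hn : m + r = n) {θ : EuclideanSpace ℂ κ}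
    (h : ∑ a, star (θ a) * θ a = 1) {R : Matrix (Fin n → κ) (Fin n → κ) ℂ} (hR : R.IsHermitian)
    (hsupp : opSupport R ≤ Submodule.span ℂ (defectVectors hn θ)) :
    (∑ T with T.card ≤ r, defectProj θ T) * R = R := by
  have hzero : ∀ T : Finset (Fin n), r < T.card → defectProj θ T * R = 0 := by
    intro T hT
    have hker : Submodule.span ℂ (defectVectors hn θ) ≤
        LinearMap.ker (Matrix.toEuclideanLin (defectProj θ T)) := by
      rw [Submodule.span_le]
      intro ψ hψ
      rw [SetLike.mem_coe, LinearMap.mem_ker, Matrix.toLpLin_apply,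
        defectProj_mulVec_defectVectors hn h hT hψ]
      rfl
    -- Each column of `R` lies in the range of `R`, hence in its support.
    refine Matrix.ext_of_mulVec_single fun i => ?_
    have := hker (hsupp (mulVec_mem_opSupport hR (Pi.single i 1)))
    rw [LinearMap.mem_ker, Matrix.toLpLin_apply] at this
    rw [← Matrix.mulVec_mulVec, Matrix.zero_mulVec]
    exact congrArg WithLp.ofLp this
  have hsplit := Finset.sum_filter_add_sum_filter_not Finset.univ
    (fun T : Finset (Fin n) => T.card ≤ r) (fun T => defectProj θ T * R)
  rw [Finset.sum_eq_zero (s := Finset.univ.filter fun T : Finset (Fin n) => ¬ T.card ≤ r)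
    fun T hT => hzero T (not_le.1 (Finset.mem_filter.1 hT).2), add_zero, ← Finset.sum_mul,
    ← Finset.sum_mul, sum_defectProj, Matrix.one_mul] at hsplit
  exact hsplit

end Defect

end AlmostIID

namespace AlmostIID

/-! ### Hoeffding's lemma, Hamming balls, the limit in (b). -/

section Analysis

/-- Hoeffding's lemma for a Bernoulli variable. -/
theorem bernoulli_mgf_le {q : ℝ} (h0 : 0 ≤ q) (h1 : q ≤ 1) (s : ℝ) :
    q * Real.exp (s * (1 - q)) + (1 - q) * Real.exp (s * (0 - q)) ≤ Real.exp (s ^ 2 / 8) := by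
  open MeasureTheory ProbabilityTheory in
  let μ : Measure ℝ := ENNReal.ofReal q • Measure.dirac 1 + ENNReal.ofReal (1 - q) • Measure.dirac 0
  have hμ : IsProbabilityMeasure μ := ⟨by
    simp only [μ, Measure.add_apply, Measure.smul_apply, measure_univ, smul_eq_mul, mul_one]
    rw [← ENNReal.ofReal_add h0 (by linarith)]
    simp⟩
  have hint : ∀ f : ℝ → ℝ, ∫ x, f x ∂μ = q * f 1 + (1 - q) * f 0 := by
    intro f
    have hf : ∀ a : ℝ, Integrable f (Measure.dirac a) := fun a =>
      integrable_dirac (by simp)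
    rw [integral_add_measure ((hf 1).smul_measure (by simp)) ((hf 0).smul_measure (by simp)),
      integral_smul_measure, integral_smul_measure, integral_dirac, integral_dirac,
      ENNReal.toReal_ofReal h0, ENNReal.toReal_ofReal (by linarith)]
    simp
  have hmem : ∀ᵐ x ∂μ, (id x : ℝ) ∈ Set.Icc (0 : ℝ) 1 := by
    simp only [μ, ae_add_measure_iff]
    constructor <;> refine Measure.ae_smul_measure ?_ _ <;> simp [ae_dirac_eq]
  have h := (hasSubgaussianMGF_of_mem_Icc (μ := μ) (X := id) aemeasurable_id hmem).mgf_le s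
  rw [mgf, hint, hint] at h
  simp only [id, mul_one, mul_zero, add_zero] at h
  refine h.trans (Real.exp_le_exp.2 (le_of_eq ?_))
  simp
  ring

theorem binEntropyBits_eq (x : ℝ) : binEntropyBits x = Real.binEntropy x / Real.log 2 := by
  simp only [binEntropyBits, Real.logb, Real.binEntropy, Real.log_inv]
  ring

/-- Volume bound for Hamming balls. -/
theorem card_filter_card_le_exp_binEntropy {n r : ℕ} (hn : 0 < n) (hr : (r : ℝ) ≤ n / 2) :
    ((Finset.univ.filter fun T : Finset (Fin n) => T.card ≤ r).card : ℝ) ≤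
      Real.exp (n * Real.binEntropy (r / n)) := by
  have hn' : (0 : ℝ) < n := by exact_mod_cast hn
  have hrn : r ≤ n := by
    have : (r : ℝ) ≤ n := by linarith
    exact_mod_cast this
  set p : ℝ := r / n with hp
  have hp0 : 0 ≤ p := by positivity
  have hp2 : p ≤ 1 / 2 := by rw [hp, div_le_iff₀ hn']; linarith
  have hexp : Real.exp (-(n * Real.binEntropy p)) = p ^ r * (1 - p) ^ (n - r) := by
    have hr' : (r : ℝ) = n * p := by rw [hp]; field_simp
    have hnr : ((n - r : ℕ) : ℝ) = n * (1 - p) := by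
      rw [Nat.cast_sub hrn, hr']; ring
    have h1 : p ^ r = Real.exp (r * Real.log p) := by
      rcases Nat.eq_zero_or_pos r with h | h
      · simp [h]
      · have : 0 < p := by positivity
        rw [Real.exp_nat_mul, Real.exp_log this]
    have h2 : (1 - p) ^ (n - r) = Real.exp ((n - r : ℕ) * Real.log (1 - p)) := by
      rw [Real.exp_nat_mul, Real.exp_log (by linarith)]
    rw [h1, h2, ← Real.exp_add, hr', hnr, Real.binEntropy, Real.log_inv, Real.log_inv]
    congr 1
    ring
  -- Include each site independently with probability `p = r/n`. As `p ≤ 1/2`, every `T` in the ball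
  -- has weight at least `p^r (1-p)^(n-r) = exp(-n H(p))`, and the weights total `1`.
  have hsum : ∑ T : Finset (Fin n), p ^ T.card * (1 - p) ^ (n - T.card) = 1 := by
    rw [Fin.sum_pow_mul_eq_add_pow]; simp
  have hle : ((Finset.univ.filter fun T : Finset (Fin n) => T.card ≤ r).card : ℝ) *
      (p ^ r * (1 - p) ^ (n - r)) ≤ 1 := by
    rw [← nsmul_eq_mul, ← Finset.sum_const]
    refine le_trans ?_ hsum.le
    refine (Finset.sum_le_sum fun T hT => ?_).trans (Finset.sum_le_sum_of_subset_of_nonneg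
      (Finset.filter_subset _ _) fun T _ _ => ?_)
    · have hT' := (Finset.mem_filter.1 hT).2
      obtain ⟨k, hk⟩ := Nat.exists_eq_add_of_le hT'
      have e1 : n - T.card = (n - r) + k := by omega
      rw [e1]
      calc p ^ r * (1 - p) ^ (n - r) = p ^ T.card * (p ^ k * (1 - p) ^ (n - r)) := by
            conv_lhs => rw [hk]
            rw [pow_add, mul_assoc, ← hk]
        _ ≤ p ^ T.card * ((1 - p) ^ k * (1 - p) ^ (n - r)) := by
            have : p ≤ 1 - p := by linarith
            have : 0 ≤ 1 - p := by linarith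
            gcongr
        _ = _ := by ring
    · have : 0 ≤ 1 - p := by linarith
      positivity
  rw [← hexp, Real.exp_neg, ← div_eq_mul_inv, div_le_one (Real.exp_pos _)] at hle
  exact hle

theorem tendsto_deviation (c d : ℕ) (ε : ℝ) {r : ℕ → ℕ}
    (hr : (fun n => (r n : ℝ)) =o[atTop] (fun n : ℕ => (n : ℝ))) :
    Tendsto (fun n => deviation c d ε (r n) n) atTop (𝓝 0) := by
  have hrn : Tendsto (fun n => (r n : ℝ) / n) atTop (𝓝 0) := hr.tendsto_div_nhds_zero
  have hlog : Tendsto (fun n : ℕ => (1 : ℝ) / n * Real.log ((n : ℝ) / 2 + 1)) atTop (𝓝 0) := by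
    have h1 : Tendsto (fun n : ℕ => (n : ℝ) / 2 + 1) atTop atTop :=
      tendsto_atTop_add_const_right _ _ (tendsto_natCast_atTop_atTop.atTop_div_const (by norm_num))
    have h2 := (Real.isLittleO_log_id_atTop.comp_tendsto h1)
    have h3 : (fun n : ℕ => (n : ℝ) / 2 + 1) =O[atTop] fun n : ℕ => (n : ℝ) := by
      refine IsBigO.of_bound 2 ?_
      filter_upwards [eventually_ge_atTop 1] with n hn
      have : (1 : ℝ) ≤ n := by exact_mod_cast hn
      rw [Real.norm_of_nonneg (by positivity), Real.norm_of_nonneg (by positivity)]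
      linarith
    have h4 := (h2.trans_isBigO h3).tendsto_div_nhds_zero
    refine h4.congr fun n => ?_
    simp only [Function.comp]
    ring
  have hent : Tendsto (fun n => Real.binEntropy ((r n : ℝ) / n)) atTop (𝓝 0) := by
    have := (Real.binEntropy_continuous.tendsto 0).comp hrn
    rwa [Real.binEntropy_zero] at this
  have hA : Tendsto (fun n : ℕ => Real.logb 2 (1 / ε) / n
      + (c : ℝ) / n * Real.logb 2 ((n : ℝ) / 2 + 1)
      + binEntropyBits ((r n : ℝ) / n) + 2 * (r n : ℝ) / n * Real.logb 2 d) atTop (𝓝 0) := by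
    have h := (((tendsto_const_div_atTop_nhds_zero_nat (Real.logb 2 (1 / ε))).add
      (hlog.const_mul (c / Real.log 2))).add (hent.div_const (Real.log 2))).add
      (hrn.const_mul (2 * Real.logb 2 d))
    simp only [mul_zero, zero_div, add_zero] at h
    refine h.congr fun n => ?_
    simp only [binEntropyBits_eq, Real.logb]
    ring
  have h := ((Real.continuous_sqrt.tendsto 0).comp hA).const_mul 2 |>.add (hrn.const_mul 2)
  simp only [Real.sqrt_zero, mul_zero, add_zero] at h
  refine h.congr fun n => ?_
  simp only [deviation, Function.comp]
  ring

end Analysis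

/-! ### From `ℓ¹` deviation to an overrepresented event. -/

section Frequency

variable {X : Type*} [Fintype X] [DecidableEq X] {n : ℕ}

/-- If the frequencies of `x` deviate from `P` by more than `δ + 2r/n` in `ℓ¹`, then, outside any
`r` positions, some event is overrepresented by `nδ/2`. -/
theorem exists_subset_deviation {P : X → ℝ} (hP0 : ∀ y, 0 ≤ P y) (hP1 : ∑ y, P y = 1)
    (hn : 0 < n) {r : ℕ} {δ : ℝ} {x : Fin n → X} (hx : δ + 2 * r / n < l1Dist (freq x) P)
    {T : Finset (Fin n)} (hT : T.card ≤ r) :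
    ∃ A : Finset X, n * δ / 2 <
      ∑ k ∈ Tᶜ, ((if x k ∈ A then 1 else 0) - ∑ y ∈ A, P y) := by
  have hn' : (0 : ℝ) < n := by exact_mod_cast hn
  let c : Finset (Fin n) → X → ℝ := fun S y => ∑ k ∈ S, if x k = y then 1 else 0
  let D : X → ℝ := fun y => c Tᶜ y - (Tᶜ.card : ℝ) * P y
  have hc0 : ∀ S y, 0 ≤ c S y := fun S y =>
    Finset.sum_nonneg fun k _ => by split_ifs <;> norm_num
  have hc1 : ∀ S, ∑ y, c S y = S.card := fun S => by
    simp only [c]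
    rw [Finset.sum_comm]
    simp
  have hcard : (T.card : ℝ) + Tᶜ.card = n := by
    exact_mod_cast (Finset.card_add_card_compl T).trans (by simp)
  have hfreq : ∀ y, n * (freq x y - P y) = D y + (c T y - (T.card : ℝ) * P y) := by
    intro y
    have h1 : c T y + c Tᶜ y = n * freq x y := by
      simp only [c, Finset.sum_add_sum_compl, freq]
      rw [mul_div_cancel₀ _ hn'.ne']
      simp
    simp only [D]
    linear_combination (-1 : ℝ) * h1 + P y * hcard
  have hl1 : n * l1Dist (freq x) P ≤ ∑ y, |D y| + 2 * r := by
    calc n * l1Dist (freq x) P = ∑ y, |n * (freq x y - P y)| := by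
          rw [l1Dist, Finset.mul_sum]
          exact Finset.sum_congr rfl fun y _ => by rw [abs_mul, abs_of_pos hn']
      _ ≤ ∑ y, (|D y| + (c T y + (T.card : ℝ) * P y)) := by
          refine Finset.sum_le_sum fun y _ => ?_
          rw [hfreq]
          refine (abs_add_le _ _).trans ?_
          gcongr
          refine (abs_sub _ _).trans (le_of_eq ?_)
          rw [abs_of_nonneg (hc0 _ _), abs_of_nonneg (mul_nonneg (by positivity) (hP0 y))]
      _ = ∑ y, |D y| + 2 * T.card := by
          rw [Finset.sum_add_distrib, Finset.sum_add_distrib, hc1, ← Finset.mul_sum, hP1]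
          ring
      _ ≤ _ := by
          have : (T.card : ℝ) ≤ r := by exact_mod_cast hT
          linarith
  have hD0 : ∑ y, D y = 0 := by
    simp only [D, Finset.sum_sub_distrib, hc1, ← Finset.mul_sum, hP1]
    ring
  -- Since `D` sums to zero, its positive part carries half of its `ℓ¹` norm; this is the `1/2` in
  -- `n * δ / 2`.
  let A : Finset X := Finset.univ.filter fun y => 0 ≤ D y
  have habs : ∑ y, |D y| = 2 * ∑ y ∈ A, D y := by
    have h1 : ∀ y, |D y| = 2 * (if 0 ≤ D y then D y else 0) - D y := by
      intro y
      split_ifs with h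
      · rw [abs_of_nonneg h]; ring
      · rw [abs_of_neg (not_le.1 h)]; ring
    simp only [h1, Finset.sum_sub_distrib, hD0, ← Finset.mul_sum, A, Finset.sum_filter, sub_zero]
  refine ⟨A, ?_⟩
  have hA : ∑ k ∈ Tᶜ, ((if x k ∈ A then (1 : ℝ) else 0) - ∑ y ∈ A, P y) = ∑ y ∈ A, D y := by
    simp only [D, c, Finset.sum_sub_distrib, Finset.sum_const, nsmul_eq_mul, ← Finset.mul_sum]
    rw [Finset.sum_comm (s := A)]
    simp
  rw [hA]
  have h2 : n * (δ + 2 * r / n) < n * l1Dist (freq x) P := mul_lt_mul_of_pos_left hx hn'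
  have h3 : n * (δ + 2 * r / n) = n * δ + 2 * r := by field_simp
  linarith

end Frequency

end AlmostIID

namespace AlmostIID

open Matrix Kronecker

/-! ### Outcome statistics and the tail bound. -/

section Measurement

variable {ι X : Type*} [Fintype ι] [DecidableEq ι] [Fintype X] {M : X → Matrix ι ι ℂ}

theorem IsPOVM.kronecker_one (hM : IsPOVM M) (e : ℕ) :
    IsPOVM fun y => M y ⊗ₖ (1 : Matrix (Fin e) (Fin e) ℂ) := by
  refine ⟨fun y => (hM.1 y).kronecker Matrix.PosSemidef.one, ?_⟩
  rw [← Matrix.one_kronecker_one, ← hM.2]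
  ext a b
  simp [Matrix.sum_apply, Finset.sum_mul]

theorem IsPOVM.productPOVM [DecidableEq X] (hM : IsPOVM M) (n : ℕ) :
    IsPOVM (productPOVM M n) := by
  refine ⟨fun x => tensorOp_posSemidef fun k => hM.1 (x k), ?_⟩
  rw [← tensorOp_one, ← hM.2]
  exact sum_tensorOp fun _ => M

theorem IsPOVM.outcomeProb_nonneg (hM : IsPOVM M) {σ : Matrix ι ι ℂ} (hσ : IsDensity σ) (y : X) :
    0 ≤ outcomeProb M σ y :=
  (hM.1 y).re_trace_mul_nonneg hσ.1

theorem IsPOVM.ofReal_outcomeProb (hM : IsPOVM M) {σ : Matrix ι ι ℂ} (hσ : IsDensity σ) (y : X) :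
    (outcomeProb M σ y : ℂ) = (M y * σ).trace :=
  Complex.ext rfl (Complex.nonneg_iff.1 ((hM.1 y).trace_mul_nonneg hσ.1)).2

theorem IsPOVM.sum_outcomeProb (hM : IsPOVM M) {σ : Matrix ι ι ℂ} (hσ : IsDensity σ) :
    ∑ y, outcomeProb M σ y = 1 := by
  simp only [outcomeProb]
  rw [← Complex.re_sum, ← Matrix.trace_sum, ← Finset.sum_mul, hM.2, Matrix.one_mul, hσ.2,
    Complex.one_re]

theorem IsPOVM.eventProb_le_one (hM : IsPOVM M) {σ : Matrix ι ι ℂ} (hσ : IsDensity σ)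
    (W : Set X) : eventProb M σ W ≤ 1 := by
  rw [← hM.sum_outcomeProb hσ]
  exact Finset.sum_le_sum fun y _ =>
    Set.indicator_le_self' (fun _ _ => hM.outcomeProb_nonneg hσ _) y

/-- The operator-valued moment generating function of a product measurement, compressed by a
defect projection. -/
theorem sum_smul_defectProj_mul_tensorOp_mul [DecidableEq X] (hM : IsPOVM M) {σ : Matrix ι ι ℂ}
    (hσ : IsDensity σ) {e n : ℕ} {θ : EuclideanSpace ℂ (ι × Fin e)} (hθ : IsPurification σ θ)
    (T : Finset (Fin n)) (w : X → ℝ) :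
    ∑ x : Fin n → X, ((∏ k ∈ Tᶜ, w (x k) : ℝ) : ℂ) • (defectProj θ T *
        tensorOp (fun k => M (x k) ⊗ₖ (1 : Matrix (Fin e) (Fin e) ℂ)) * defectProj θ T) =
      (((∑ y, w y * outcomeProb M σ y) ^ Tᶜ.card : ℝ) : ℂ) • defectProj θ T := by
  have hunit := hθ.sum_star_mul hσ.2
  let p : Fin n → Matrix (ι × Fin e) (ι × Fin e) ℂ :=
    fun k => if k ∈ T then 1 - rankOne θ else rankOne θ
  let N : X → Matrix (ι × Fin e) (ι × Fin e) ℂ := fun y => M y ⊗ₖ 1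
  have hprod : ∀ f : Fin n → ℂ, ∏ k ∈ Tᶜ, f k = ∏ k, if k ∈ T then 1 else f k := by
    intro f
    rw [← Finset.prod_mul_prod_compl T (fun k => if k ∈ T then 1 else f k),
      Finset.prod_eq_one fun k hk => if_pos hk, one_mul]
    exact Finset.prod_congr rfl fun k hk => (if_neg (Finset.mem_compl.1 hk)).symm
  have hleft : ∀ x : Fin n → X, ((∏ k ∈ Tᶜ, w (x k) : ℝ) : ℂ) •
      (defectProj θ T * tensorOp (fun k => N (x k)) * defectProj θ T) =
      tensorOp fun k => (if k ∈ T then (1 : ℂ) else (w (x k) : ℂ)) • (p k * N (x k) * p k) := by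
    intro x
    rw [tensorOp_smul, Complex.ofReal_prod, hprod, defectProj, tensorOp_mul, tensorOp_mul]
  -- The sum over `x` factorizes over sites. On `T` the weight is `1` and completeness of the POVM
  -- returns the projection; outside `T` the rank-one compression gives the mean of `w`.
  have hsite : ∀ k, ∑ y, (if k ∈ T then (1 : ℂ) else (w y : ℂ)) • (p k * N y * p k) =
      (if k ∈ T then (1 : ℂ) else ((∑ y, w y * outcomeProb M σ y : ℝ) : ℂ)) • p k := by
    intro k
    have hpp := rankOne_mul_self hunit
    by_cases hk : k ∈ T
    · simp only [hk, if_true, one_smul, p]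
      rw [← Finset.sum_mul, ← Finset.mul_sum, (hM.kronecker_one e).2]
      simp [Matrix.sub_mul, Matrix.mul_sub, hpp]
    · simp only [hk, if_false, p, N, rankOne_mul_mul, hθ.sum_kronecker, smul_smul]
      rw [← Finset.sum_smul, Complex.ofReal_sum]
      congr 1
      refine Finset.sum_congr rfl fun y _ => ?_
      rw [Complex.ofReal_mul, hM.ofReal_outcomeProb hσ]
  rw [Finset.sum_congr rfl fun x _ => hleft x,
    sum_tensorOp fun k y => (if k ∈ T then (1 : ℂ) else (w y : ℂ)) • (p k * N y * p k),
    funext hsite, tensorOp_smul, ← hprod, Finset.prod_const, Complex.ofReal_pow, defectProj]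

theorem eventProb_l1Dist_le [DecidableEq X] (hM : IsPOVM M) {n r : ℕ} (hn : 0 < n)
    {σ : Matrix ι ι ℂ} {ρ : Matrix (Fin n → ι) (Fin n → ι) ℂ} (h : IsAlmostIID n r σ ρ)
    {δ : ℝ} (hδ : 0 ≤ δ) :
    eventProb (productPOVM M n) ρ {x | δ + 2 * r / n < l1Dist (freq x) (outcomeProb M σ)} ≤
      (Finset.univ.filter fun T : Finset (Fin n) => T.card ≤ r).card *
        (2 ^ Fintype.card X * Real.exp (-(n * δ ^ 2 / 2))) := by
  obtain ⟨hσ, -, hr, e, θ, R, hθ, hR, rfl, -, hsupp⟩ := h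
  set W : Set (Fin n → X) := {x | δ + 2 * r / n < l1Dist (freq x) (outcomeProb M σ)} with hW
  set S := Finset.univ.filter fun T : Finset (Fin n) => T.card ≤ r with hS
  have hunit := hθ.sum_star_mul hσ.2
  let P := outcomeProb M σ
  have hP0 : ∀ y, 0 ≤ P y := hM.outcomeProb_nonneg hσ
  have hP1 : ∑ y, P y = 1 := hM.sum_outcomeProb hσ
  let L : (Fin n → X) → Matrix (Fin n → ι × Fin e) (Fin n → ι × Fin e) ℂ :=
    fun x => tensorOp (fun k => M (x k) ⊗ₖ (1 : Matrix (Fin e) (Fin e) ℂ))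
  have hL : ∀ x, (L x).PosSemidef := fun x =>
    tensorOp_posSemidef fun k => (hM.kronecker_one e).1 (x k)
  let q : (Fin n → X) → Finset (Fin n) → ℝ :=
    fun x T => (defectProj θ T * L x * defectProj θ T * R).trace.re
  have hq : ∀ x T, 0 ≤ q x T := by
    intro x T
    have h1 := (hL x).conjTranspose_mul_mul_same (defectProj θ T)
    rw [(defectProj_isHermitian θ T).eq] at h1
    exact h1.re_trace_mul_nonneg hR.1
  let t : Finset (Fin n) → ℝ := fun T => (defectProj θ T * R).trace.re
  have ht : ∀ T, 0 ≤ t T := by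
    intro T
    have h1 := Matrix.posSemidef_conjTranspose_mul_self (defectProj θ T)
    rw [(defectProj_isHermitian θ T).eq, defectProj_mul_self hunit] at h1
    exact h1.re_trace_mul_nonneg hR.1
  have hPiR := sum_defectProj_mul_eq (Nat.sub_add_cancel hr) hunit hR.1.isHermitian hsupp
  -- The `t T` form a probability distribution over defect sets, so averaging over `T` costs nothing
  -- beyond the single pinching factor `S.card`.
  have htsum : ∑ T ∈ S, t T = 1 := by
    simp only [t]
    rw [← Complex.re_sum, ← Matrix.trace_sum, ← Finset.sum_mul, hPiR, hR.2, Complex.one_re]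
  have hRPi : R * ∑ T ∈ S, defectProj θ T = R := by
    have h1 := congrArg Matrix.conjTranspose hPiR
    rw [Matrix.conjTranspose_mul, hR.1.isHermitian.eq, Matrix.conjTranspose_sum,
      Finset.sum_congr rfl fun T _ => (defectProj_isHermitian θ T).eq] at h1
    exact h1
  have hprob : ∀ x, outcomeProb (productPOVM M n) (partialTrace R) x ≤ S.card * ∑ T ∈ S, q x T := by
    intro x
    refine le_trans (le_of_eq ?_) (re_trace_pinching (hL x) hR.1 S (defectProj θ)
      (defectProj_isHermitian θ))
    rw [outcomeProb, productPOVM, trace_tensorOp_mul_partialTrace, Matrix.mul_assoc, hPiR,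
      Matrix.mul_assoc, Matrix.trace_mul_comm (∑ T ∈ S, defectProj θ T), Matrix.mul_assoc, hRPi]
  let PA : Finset X → ℝ := fun A => ∑ y ∈ A, P y
  -- Exponential Markov weight. The parameter `s = 2δ` minimizes `n s²/8 - s n δ/2`, with value
  -- `-nδ²/2`.
  let w : Finset X → X → ℝ := fun A y => Real.exp (2 * δ * ((if y ∈ A then 1 else 0) - PA A))
  let g : (Fin n → X) → Finset (Fin n) → Finset X → ℝ := fun x T A =>
    Real.exp (-(n * δ ^ 2)) * ((∏ k ∈ Tᶜ, w A (x k)) * q x T)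
  have hg : ∀ x T A, 0 ≤ g x T A := fun x T A =>
    mul_nonneg (Real.exp_pos _).le
      (mul_nonneg (Finset.prod_nonneg fun k _ => (Real.exp_pos _).le) (hq x T))
  have hpoint : ∀ x ∈ W, ∀ T ∈ S, q x T ≤ ∑ A, g x T A := by
    intro x hx T hT
    obtain ⟨A, hA⟩ := exists_subset_deviation hP0 hP1 hn hx (Finset.mem_filter.1 hT).2
    refine le_trans ?_ (Finset.single_le_sum (fun A _ => hg x T A) (Finset.mem_univ A))
    simp only [g, w]
    rw [← mul_assoc, ← Real.exp_sum, ← Real.exp_add, ← Finset.mul_sum]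
    refine le_mul_of_one_le_left (hq x T) (Real.one_le_exp ?_)
    have := mul_le_mul_of_nonneg_left hA.le (by linarith : 0 ≤ 2 * δ)
    linarith
  have hmgf : ∀ T A, ∑ x, g x T A ≤ Real.exp (-(n * δ ^ 2 / 2)) * t T := by
    intro T A
    have h1 := congrArg (fun B => (B * R).trace.re)
      (sum_smul_defectProj_mul_tensorOp_mul hM hσ hθ T (w A))
    simp only [Finset.sum_mul, Matrix.smul_mul, Matrix.trace_sum, Matrix.trace_smul,
      Complex.re_sum, smul_eq_mul, Complex.re_ofReal_mul] at h1
    have hPA0 : 0 ≤ PA A := Finset.sum_nonneg fun y _ => hP0 y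
    have hcompl : PA A + ∑ y ∈ Aᶜ, P y = 1 := by rw [← hP1, ← Finset.sum_add_sum_compl A]
    have hPA1 : PA A ≤ 1 := by
      have : 0 ≤ ∑ y ∈ Aᶜ, P y := Finset.sum_nonneg fun y _ => hP0 y
      linarith
    have hE : ∑ y, w A y * P y ≤ Real.exp ((2 * δ) ^ 2 / 8) := by
      refine le_trans (le_of_eq ?_) (bernoulli_mgf_le hPA0 hPA1 (2 * δ))
      have h2 : 1 - PA A = ∑ y ∈ Aᶜ, P y := by linarith
      rw [← Finset.sum_add_sum_compl A, show (1 - PA A) * Real.exp (2 * δ * (0 - PA A)) =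
        (∑ y ∈ Aᶜ, P y) * Real.exp (2 * δ * (0 - PA A)) by rw [h2], Finset.sum_mul, Finset.sum_mul]
      congr 1
      · exact Finset.sum_congr rfl fun y hy => by simp only [w, hy, if_true, PA]; ring
      · exact Finset.sum_congr rfl fun y hy => by
          simp only [w, Finset.mem_compl.1 hy, if_false, PA]; ring
    have hE0 : 0 ≤ ∑ y, w A y * P y :=
      Finset.sum_nonneg fun y _ => mul_nonneg (Real.exp_pos _).le (hP0 y)
    have hpow : (∑ y, w A y * P y) ^ Tᶜ.card ≤ Real.exp (n * δ ^ 2 / 2) := by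
      refine (pow_le_pow_left₀ hE0 hE _).trans ?_
      rw [← Real.exp_nat_mul, Real.exp_le_exp]
      have : (Tᶜ.card : ℝ) ≤ n := by exact_mod_cast (Finset.card_le_univ _).trans (by simp)
      nlinarith [mul_le_mul_of_nonneg_right this (sq_nonneg δ)]
    simp only [g]
    rw [← Finset.mul_sum, h1, ← mul_assoc]
    refine mul_le_mul_of_nonneg_right ?_ (ht T)
    calc Real.exp (-(n * δ ^ 2)) * (∑ y, w A y * P y) ^ Tᶜ.card
        ≤ Real.exp (-(n * δ ^ 2)) * Real.exp (n * δ ^ 2 / 2) := by gcongr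
      _ = Real.exp (-(n * δ ^ 2 / 2)) := by rw [← Real.exp_add]; congr 1; ring
  calc eventProb (productPOVM M n) (partialTrace R) W
      ≤ ∑ x, S.card * ∑ T ∈ S, ∑ A, g x T A := by
        refine Finset.sum_le_sum fun x _ => ?_
        by_cases hx : x ∈ W
        · rw [Set.indicator_of_mem hx]
          refine (hprob x).trans ?_
          gcongr with T hT
          exact hpoint x hx T hT
        · rw [Set.indicator_of_notMem hx]
          exact mul_nonneg (Nat.cast_nonneg _)
            (Finset.sum_nonneg fun T _ => Finset.sum_nonneg fun A _ => hg x T A)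
    _ = S.card * ∑ T ∈ S, ∑ A, ∑ x, g x T A := by
        rw [← Finset.mul_sum, Finset.sum_comm]
        congr 1
        exact Finset.sum_congr rfl fun T _ => Finset.sum_comm
    _ ≤ S.card * ∑ T ∈ S, ∑ A : Finset X, Real.exp (-(n * δ ^ 2 / 2)) * t T := by
        gcongr with T _ A _
        exact hmgf T A
    _ = _ := by
        simp only [Finset.sum_const, Finset.card_univ, Fintype.card_finset, nsmul_eq_mul,
          ← Finset.mul_sum, htsum]
        push_cast
        ring

theorem card_mul_exp_le_of_deviation {n r : ℕ} (hn : 0 < n) (hr : (r : ℝ) ≤ n / 2) (c d : ℕ)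
    {ε A : ℝ} (hε : 0 < ε) (hε1 : ε ≤ 1)
    (hA : A = Real.logb 2 (1 / ε) / n + (c : ℝ) / n * Real.logb 2 ((n : ℝ) / 2 + 1)
      + binEntropyBits ((r : ℝ) / n) + 2 * (r : ℝ) / n * Real.logb 2 d) :
    (Finset.univ.filter fun T : Finset (Fin n) => T.card ≤ r).card *
        (2 ^ c * Real.exp (-(n * (2 * √A) ^ 2 / 2))) ≤ ε := by
  have hn' : (0 : ℝ) < n := by exact_mod_cast hn
  have hn1 : (1 : ℝ) ≤ n := by exact_mod_cast hn
  have hl2 : 0 < Real.log 2 := Real.log_pos (by norm_num)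
  have hl2' : Real.log 2 ≤ 1 := by linarith [Real.log_two_lt_d9]
  have hlε : Real.log ε ≤ 0 := Real.log_nonpos hε.le hε1
  have hH : 0 ≤ Real.binEntropy (r / n) := Real.binEntropy_nonneg (by positivity)
    ((div_le_one hn').2 (by linarith))
  have hd : 0 ≤ Real.log d := Real.log_natCast_nonneg d
  -- The exponent is `n(2√A)²/2 = 2nA ≥ 2nA log 2`, so each term of the radicand counts twice. The
  -- doubled alphabet term pays for `2^c`, because `(n/2 + 1)² ≥ 9/4 > 2` for `n ≥ 1`; the dimension
  -- term is nonnegative and is dropped.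
  have hq : Real.log 2 ≤ 2 * Real.log ((n : ℝ) / 2 + 1) := by
    rw [← Real.log_rpow (by positivity)]
    refine Real.log_le_log (by norm_num) ?_
    norm_num
    nlinarith
  have hAn : n * A * Real.log 2 = -Real.log ε + c * Real.log ((n : ℝ) / 2 + 1)
      + n * Real.binEntropy (r / n) + 2 * r * Real.log d := by
    rw [hA, binEntropyBits_eq]
    simp only [Real.logb, one_div, Real.log_inv]
    field_simp
  have hcq : c * Real.log 2 ≤ c * (2 * Real.log ((n : ℝ) / 2 + 1)) := by gcongr
  have hc0 : 0 ≤ c * Real.log 2 := by positivity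
  have hnH : 0 ≤ n * Real.binEntropy (r / n) := by positivity
  have hrd : 0 ≤ 2 * r * Real.log d := by positivity
  have hA0 : 0 ≤ n * A := by
    refine nonneg_of_mul_nonneg_left ?_ hl2
    rw [hAn]
    linarith
  have hA0' : 0 ≤ A := nonneg_of_mul_nonneg_right hA0 hn'
  have hscale : n * A * Real.log 2 ≤ n * A := mul_le_of_le_one_right hA0 hl2'
  calc _ ≤ Real.exp (n * Real.binEntropy (r / n)) *
        (Real.exp (c * Real.log 2) * Real.exp (-(n * (2 * √A) ^ 2 / 2))) := by
        rw [Real.exp_nat_mul (Real.log 2), Real.exp_log (by norm_num : (0 : ℝ) < 2)]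
        gcongr
        exact card_filter_card_le_exp_binEntropy hn hr
    _ ≤ Real.exp (Real.log ε) := by
        rw [← Real.exp_add, ← Real.exp_add, Real.exp_le_exp, mul_pow, Real.sq_sqrt hA0']
        linarith
    _ = ε := Real.exp_log hε

end Measurement

end AlmostIID

theorem mainTheorem5 {ι X : Type*} [Fintype ι] [DecidableEq ι] [Fintype X] [DecidableEq X]
    (M : X → Matrix ι ι ℂ) (hM : IsPOVM M) :
    (∀ (n r : ℕ), 0 < n → (r : ℝ) ≤ (n : ℝ) / 2 →
      ∀ (σ : Matrix ι ι ℂ) (ρ : Matrix (Fin n → ι) (Fin n → ι) ℂ), IsAlmostIID n r σ ρ →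
      ∀ ε : ℝ, 0 < ε →
        eventProb (productPOVM M n) ρ
          {x | deviation (Fintype.card X) (Fintype.card ι) ε r n
            < l1Dist (freq x) (outcomeProb M σ)} ≤ ε) ∧
    (∀ ε : ℝ, 0 < ε → ∀ r : ℕ → ℕ,
      (fun n => (r n : ℝ)) =o[atTop] (fun n : ℕ => (n : ℝ)) →
      Tendsto (fun n => deviation (Fintype.card X) (Fintype.card ι) ε (r n) n) atTop (𝓝 0)) := by
  refine ⟨fun n r hn hr σ ρ h ε hε => ?_, fun ε _ r hr => tendsto_deviation _ _ ε hr⟩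
  -- For `ε ≤ 1` the radicand is nonnegative, so squaring the root recovers it; for `ε ≥ 1` any
  -- probability is at most `ε`, whatever the root's default value.
  rcases le_total ε 1 with hε1 | hε1
  · exact (eventProb_l1Dist_le hM hn h (by positivity)).trans
      (card_mul_exp_le_of_deviation hn hr _ _ hε hε1 rfl)
  · exact ((hM.productPOVM n).eventProb_le_one h.2.1 _).trans hε1
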